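/- Let $A=(a_1,\dots,a_n)$ be a configuration of points in $\mathbb R^d$, possibly repeated or affinely dependent, whose affine span is $\mathbb R^d$; put $v_i=(a_i,1)\in\mathbb R^{d+1}$ and $Z(V)=\sum_{i=1}^n[0,v_i]$. For disjoint $I,B\subseteq[n]$ with $|B|=d+1$ and $(a_b)_{b\in B}$ affinely independent, let $\Pi_{I,B}=\sum_{i\in I}v_i+\sum_{b\in B}[0,v_b]$; its order is $|I|$. Its faces are the sets $\Pi_{J,C}=\sum_{j\in J}v_j+\sum_{c\in C}[0,v_c]$ with $C\subseteq B$, $I\subseteq J\subseteq I\cup B$ and $J\cap C=\varnothing$. A fine zonotopal tiling $\mathcal P$ of $Z(V)$ is a set of such parallelepipeds (labelled by their pairs $(I,B)$) whose union is $Z(V)$ and any two of which are disjoint or meet in a common face $\Pi_{J,C}$ (with the same label $(J,C)$ in both). Given a choice of a set $\mathcal T_I$ of $(d+1)$-subsets of $[n]$ for each $I\subseteq[n]$, the following process is considered. Start with $\mathcal I^{(0)}=\{\varnothing\}$. In step $k=0,1,\dots,n-d-1$, build the tiles $\Pi_{I,B}$ with $I\in\mathcal I^{(k)}$ and $B\in\mathcal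 T_I$, and let $\mathcal I^{(k+1)}$ be the set of all $I\sqcup\{b\}$ such that $\Pi_{I,B}$ was built in step $k$, $b\in B$ and $\mathcal R(I\sqcup\{b\})\neq\varnothing$. Here, for $Q\subseteq[n]$, the link region $\mathcal R(Q)$ is the closure of the set of interior points of $\mathrm{conv}\{a_i:i\notin Q\}$ that do not lie in any simplex $\mathrm{conv}\{a_b:b\in B\}$ of a tile $\Pi_{I,B}$ built in a step $r<|Q|$ with $I\subseteq Q$ and $B\cap Q=\varnothing$. The process constructs $\mathcal P$ if for all $0\le k\le n-d-1$ the following holds: for every $I\in\mathcal I^{(k)}$, the simplices $\mathrm{conv}\{a_b:b\in B\}$, $B\in\mathcal T_I$, form a triangulation of $\mathcal R(I)$ by nondegenerate $d$-simplices with $B\cap I=\varnothing$ (their union is $\mathcal R(I)$, and any two of them, with vertex sets $B,B'$, meet exactly in $\mathrm{conv}\{a_b:b\in B\cap B'\}$); and the tiles built in step $k$ are exactly the tiles of order $k$ of $\mathcal P$. The spline functions of order $k$ built by the process are the multivariate (simplex) splines $M(\,\cdot\,|(a_i)_{i\in I\sqcup B})$, one for each tile $\Pi_{I,B}$ built in step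 $k$, where for $|X|=k+d+1$ the function $M(x|(a_i)_{i\in X})$ is $\frac{d!}{\det(X)}\mathbf 1_{\mathrm{conv}\{a_i:i\in X\}}(x)$ if $k=0$ and $\frac{k+d}{k}\sum_{b\in B}\frac{\det(B;\,b\to x)}{\det(B)}M(x|(a_i)_{i\in X\setminus\{b\}})$ if $k\ge1$, for some $B\subseteq X$ with $|B|=d+1$ and $(a_b)_{b\in B}$ affinely independent, and $M=0$ if there is no such $B$; here $\det(B)>0$ is the determinant of the suitably ordered rows $(a_b,1)$, $b\in B$, and $\det(B;\,b\to x)$ is obtained from it by replacing the row of $b$ by $(x,1)$ (different tiles count separately, even if their spline functions coincide). Then, for every fine zonotopal tiling $\mathcal P$ of $Z(V)$ and every choice of the $\mathcal T_I$ for which the process constructs $\mathcal P$, the total number of spline functions built, summed over all orders $k=0,\dots,n-d-1$, is equal to the number of sets $B\subseteq[n]$ with $|B|=d+1$ such that $(a_b)_{b\in B}$ is affinely independent. -/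

import Mathlib

namespace ZonotopalSplines

variable {n d : ℕ}

/-! Points live in `ℝ^d = Fin d → ℝ`; only its linear structure and its topology are used. A point
configuration is a family `a : Fin n → Fin d → ℝ` (points may be repeated), and "subsets of the
configuration" are sets of indices. -/

/-- The projective lift `(x, 1) ∈ ℝ^(d+1)` of a point `x ∈ ℝ^d`. -/
def lift (x : Fin d → ℝ) : Fin (d + 1) → ℝ := Fin.snoc (α := fun _ => ℝ) x 1

/-- The square matrix with rows `(a_i, 1)`, `i ∈ B`, where `|B| = d + 1`, in increasing order of the
indices. -/
noncomputable def rowMatrix (a : Fin n → Fin d → ℝ) (B : Finset (Fin n)) (h : B.card = d + 1) :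
    Matrix (Fin (d + 1)) (Fin (d + 1)) ℝ :=
  Matrix.of fun r => lift (a (B.orderEmbOfFin h r))

/-- `det(B)`: the determinant of the rows `(a_i, 1)`, `i ∈ B`, ordered so that it is nonnegative;
it is set to `0` when `B` does not have `d + 1` elements. -/
noncomputable def det (a : Fin n → Fin d → ℝ) (B : Finset (Fin n)) : ℝ :=
  if h : B.card = d + 1 then |(rowMatrix a B h).det| else 0

/-- The quotient `det(B; b → x) / det(B)`, where in the numerator the row of `b` is replaced by
`(x, 1)` (and the order of the rows is the same in both determinants). -/
noncomputable def detRatio (a : Fin n → Fin d → ℝ) (B : Finset (Fin n)) (b : Fin n)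
    (x : Fin d → ℝ) : ℝ :=
  if h : B.card = d + 1 then
    (rowMatrix (Function.update a b x) B h).det / (rowMatrix a B h).det
  else 0

/-- The convex hull of the points indexed by `X`. -/
def hull (a : Fin n → Fin d → ℝ) (X : Finset (Fin n)) : Set (Fin d → ℝ) :=
  convexHull ℝ (a '' (X : Set (Fin n)))

/-! ### Simplex splines -/

open Classical in
/-- The recursion defining the normalized multivariate spline of degree `k` on `k + d + 1` points:
`d! / det(X)` on the simplex for `k = 0`, and
`(k + d) / k * ∑_{b ∈ B} det(B; b → x) / det(B) * M(x | X \ {b})` for `k > 0`, where `B ⊆ X` is some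
affinely independent set of `d + 1` indices; the spline is `0` if there is no such `B`. -/
noncomputable def splineAux (a : Fin n → Fin d → ℝ) :
    ℕ → Finset (Fin n) → (Fin d → ℝ) → ℝ
  | 0, X, x =>
      if 0 < det a X then
        (d.factorial : ℝ) / det a X * (hull a X).indicator (fun _ => (1 : ℝ)) x
      else 0
  | k + 1, X, x =>
      if h : ∃ B ⊆ X, 0 < det a B then
        ((k + 1 + d : ℕ) : ℝ) / ((k + 1 : ℕ) : ℝ) *
          ∑ b ∈ h.choose, detRatio a h.choose b x * splineAux a k (X.erase b) x
      else 0

/-- The normalized multivariate spline `M(x | (a_i)_{i ∈ X})`, of degree `|X| - d - 1`. -/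
noncomputable def spline (a : Fin n → Fin d → ℝ) (X : Finset (Fin n)) : (Fin d → ℝ) → ℝ :=
  splineAux a (X.card - (d + 1)) X

/-! ### Zonotopes and fine zonotopal tilings -/

/-- The zonotope `Z(V) = ∑_i [0, v_i] ⊆ ℝ^(d+1)` with `v_i = (a_i, 1)`. -/
def zonotope (a : Fin n → Fin d → ℝ) : Set (Fin (d + 1) → ℝ) :=
  {z | ∃ α : Fin n → ℝ, (∀ i, 0 ≤ α i ∧ α i ≤ 1) ∧ z = ∑ i, α i • lift (a i)}

/-- `Π_{I,B} = ∑_{i ∈ I} v_i + ∑_{b ∈ B} [0, v_b]`. -/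
def parallelepiped (a : Fin n → Fin d → ℝ) (I B : Finset (Fin n)) : Set (Fin (d + 1) → ℝ) :=
  {z | ∃ α : Fin n → ℝ, (∀ b ∈ B, 0 ≤ α b ∧ α b ≤ 1) ∧
    z = ∑ i ∈ I, lift (a i) + ∑ b ∈ B, α b • lift (a b)}

/-- A (label of a) tile `Π_{I,B}` is the pair `(I, B)`. -/
abbrev Tile (n : ℕ) : Type := Finset (Fin n) × Finset (Fin n)

/-- `Π_{J,C}` is the face of `Π_{I,B}` obtained by setting the coefficients of the segments
`[0, v_b]`, `b ∈ B \ C`, to `1` if `b ∈ J` and to `0` if `b ∉ J`. -/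
def IsFace (J C I B : Finset (Fin n)) : Prop :=
  C ⊆ B ∧ I ⊆ J ∧ J ⊆ I ∪ B ∧ Disjoint J C

/-- A fine zonotopal tiling of `Z(V)`: a set of parallelepipeds `Π_{I,B}` with `I ∩ B = ∅`,
`|B| = d + 1` and `det(B) > 0`, which cover exactly `Z(V)` and any two of which either are disjoint
or meet in a common face. -/
structure IsFineZonotopalTiling (a : Fin n → Fin d → ℝ) (P : Finset (Tile n)) : Prop where
  disjoint : ∀ t ∈ P, Disjoint t.1 t.2
  card_eq : ∀ t ∈ P, t.2.card = d + 1
  det_pos : ∀ t ∈ P, 0 < det a t.2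
  cover : ⋃ t ∈ P, parallelepiped a t.1 t.2 = zonotope a
  inter : ∀ t ∈ P, ∀ t' ∈ P,
    (parallelepiped a t.1 t.2 ∩ parallelepiped a t'.1 t'.2).Nonempty →
    ∃ J C : Finset (Fin n), IsFace J C t.1 t.2 ∧ IsFace J C t'.1 t'.2 ∧
      parallelepiped a t.1 t.2 ∩ parallelepiped a t'.1 t'.2 = parallelepiped a J C

/-- The tiles of order `k`, i.e. with `|I| = k`. -/
def tilesOfOrder (P : Finset (Tile n)) (k : ℕ) : Finset (Tile n) :=
  P.filter fun t => t.1.card = k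

/-! ### Triangulations and link regions -/

/-- `T` is (the set of vertex sets of) a triangulation of the region `R`, by nondegenerate
`d`-simplices with vertices among the points with index outside `Q`: the simplices cover exactly `R`
and any two of them meet in their common, possibly empty, face. -/
structure IsTriangulation (a : Fin n → Fin d → ℝ) (Q : Finset (Fin n)) (R : Set (Fin d → ℝ))
    (T : Finset (Finset (Fin n))) : Prop where
  disjoint : ∀ B ∈ T, Disjoint B Q
  card_eq : ∀ B ∈ T, B.card = d + 1
  det_pos : ∀ B ∈ T, 0 < det a B
  cover : ⋃ B ∈ T, hull a B = R
  inter : ∀ B ∈ T, ∀ B' ∈ T, hull a B ∩ hull a B' = hull a (B ∩ B')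

/-- `E^(r)(Q)`: the union of the simplices `conv (a_b)_{b ∈ B}` over the tiles `Π_{I,B}` of order `r`
in `S` with `B ∩ Q = ∅` and `I ⊆ Q`. -/
def linkPart (a : Fin n → Fin d → ℝ) (S : Finset (Tile n)) (r : ℕ) (Q : Finset (Fin n)) :
    Set (Fin d → ℝ) :=
  ⋃ t ∈ (tilesOfOrder S r).filter (fun t => Disjoint t.2 Q ∧ t.1 ⊆ Q), hull a t.2

/-- The link region of `Q`, computed from the set `S` of tiles of order less than `|Q|`: it is
`conv (a_i)_{i ∉ Q}` minus the union of the `E^(r)(Q)`, `r < |Q|`. The difference is that of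
full-dimensional closed polyhedral regions, i.e. the closure of the set of interior points of
`conv (a_i)_{i ∉ Q}` that are outside all `E^(r)(Q)`. -/
def linkRegion (a : Fin n → Fin d → ℝ) (S : Finset (Tile n)) (Q : Finset (Fin n)) :
    Set (Fin d → ℝ) :=
  closure (interior (hull a Qᶜ) \ ⋃ r ∈ Finset.range Q.card, linkPart a S r Q)

/-! ### The iterative construction -/

/-- The data available at the beginning of step `k` of the construction: the tiles of all orders
less than `k`, and the family `𝓘^(k)` of index sets to be treated in step `k`. -/
structure State (n : ℕ) where
  lower : Finset (Tile n)
  sets : Finset (Finset (Fin n))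

/-- The tiles `Π_{I,B}`, `I ∈ 𝓘^(k)`, `B ∈ 𝓣_I`, built in one step with the triangulations
`𝓣_I = T I`. -/
def State.newTiles (s : State n) (T : Finset (Fin n) → Finset (Finset (Fin n))) :
    Finset (Tile n) :=
  s.sets.biUnion fun I => (T I).image fun B => (I, B)

open Classical in
/-- The construction with the triangulations `T`: `𝓘^(0) = {∅}`, and `𝓘^(k+1)` consists of the sets
`I ⊔ {b}` with nonempty link region, for the tiles `Π_{I,B}` built in step `k` and `b ∈ B`. -/
noncomputable def state (a : Fin n → Fin d → ℝ) (T : Finset (Fin n) → Finset (Finset (Fin n))) :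
    ℕ → State n
  | 0 => { lower := ∅, sets := {∅} }
  | k + 1 =>
    { lower := (state a T k).lower ∪ (state a T k).newTiles T
      sets := (((state a T k).newTiles T).biUnion fun t => t.2.image fun b => insert b t.1).filter
        fun Q => (linkRegion a ((state a T k).lower ∪ (state a T k).newTiles T) Q).Nonempty }

/-- The tiles built in step `k` of the construction. -/
noncomputable def builtTiles (a : Fin n → Fin d → ℝ)
    (T : Finset (Fin n) → Finset (Finset (Fin n))) (k : ℕ) : Finset (Tile n) :=
  (state a T k).newTiles T

/-- The construction with the choice `T` builds the tiling `P`: in each step `0 ≤ k ≤ n - d - 1`,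
for every `I ∈ 𝓘^(k)` the chosen `T I` is a triangulation of the link region of `I`, and the tiles
built are the tiles of order `k` of `P`. -/
structure Constructs (a : Fin n → Fin d → ℝ) (T : Finset (Fin n) → Finset (Finset (Fin n)))
    (P : Finset (Tile n)) : Prop where
  triangulation : ∀ k < n - d, ∀ I ∈ (state a T k).sets,
    IsTriangulation a I (linkRegion a (state a T k).lower I) (T I)
  built : ∀ k < n - d, builtTiles a T k = tilesOfOrder P k

/-- The family of spline functions of order `k` built by the construction: one spline
`M(· | (a_i)_{i ∈ I ⊔ B})` for each tile `Π_{I,B}` built in step `k`. It is a multiset, because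
different tiles can have the same spline. -/
noncomputable def builtSplines (a : Fin n → Fin d → ℝ)
    (T : Finset (Fin n) → Finset (Finset (Fin n))) (k : ℕ) : Multiset ((Fin d → ℝ) → ℝ) :=
  (builtTiles a T k).val.map fun t => spline a (t.1 ∪ t.2)

end ZonotopalSplines

namespace ZonotopalSplines

/-! Lift the tiles to faces of the cube `[0,1]^n`. They form a complex which the projection
`σ ↦ ∑ σ_i v_i` maps bijectively onto the zonotope, that is, the image of a section `s`. Along a
segment in direction `v_i` the coordinate `s_i` has slope `0` or `1` on every tile, and where it has
slope `1` the other coordinates are constant. Consequently, after deletion of `v_i` (forgetting the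
`i`-th coordinate) the complex is still a section, over the smaller zonotope: injectivity is the
slope statement and surjectivity follows from the intermediate value theorem. By repeated deletion
it is a section over the zonotope of `(v_i)_{i ∈ S}` for every `S`.

Let `B` be a basis. For `S = B` the zonotope is a parallelepiped, and the point over its centre lies
on a tile with label `B`. If there were two such tiles `(I, B)` and `(J, B)` with `i ∈ I \ J`, then
for `S = B ∪ {i}` the segment between their centres would have slope `1`, and its midpoint would lie
on a tile whose label contains `B ∪ {i}`, which is linearly dependent. Hence the tiles correspond to
the bases. -/

open Set Filter Topology

section Topology

lemma continuousOn_image_of_continuousOn_comp {X Y Z : Type*} [TopologicalSpace X]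
    [TopologicalSpace Y] [T2Space Y] [TopologicalSpace Z] {K : Set X} {f : X → Y} {g : Y → Z}
    (hK : IsCompact K) (hf : ContinuousOn f K) (hgf : ContinuousOn (g ∘ f) K) :
    ContinuousOn g (f '' K) := by
  refine continuousOn_iff_isClosed.2 fun C hC => ?_
  obtain ⟨D, hD, hDC⟩ := continuousOn_iff_isClosed.1 hgf C hC
  refine ⟨f '' (D ∩ K), ((hK.inter_left hD).image_of_continuousOn
    (hf.mono inter_subset_right)).isClosed, ?_⟩
  rw [← hDC, inter_comm _ K, preimage_comp, image_inter_preimage, inter_comm,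
    inter_eq_left.2 inter_subset_left]

lemma Icc_subset_of_finite_closed_cover {α κ : Type*} [ConditionallyCompleteLinearOrder α]
    [TopologicalSpace α] [OrderTopology α] [DenselyOrdered α] {a b : α} {s : Set α}
    {P : Finset κ} {K : κ → Set α} (hs : IsClosed (s ∩ Icc a b)) (ha : a ∈ s)
    (hK : ∀ k ∈ P, IsClosed (K k)) (hcover : Icc a b ⊆ ⋃ k ∈ P, K k)
    (hstep : ∀ k ∈ P, ∀ x ∈ K k ∩ Icc a b, ∀ y ∈ K k ∩ Icc a b, x < y → x ∈ s → y ∈ s) :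
    Icc a b ⊆ s := by
  refine hs.Icc_subset_of_forall_exists_gt ha fun x ⟨hxs, hx⟩ y hy => ?_
  have hxb : ∀ᶠ t in 𝓝[>] x, t ∈ Ioc x (min y b) := Ioc_mem_nhdsGT (lt_min hy hx.2)
  have : (𝓝[>] x).NeBot := nhdsGT_neBot_of_exists_gt ⟨b, hx.2⟩
  obtain ⟨k, hk, hfreq⟩ : ∃ k ∈ P, ∃ᶠ t in 𝓝[>] x, t ∈ K k := by
    refine (frequently_exists_finset P).1 (hxb.mono fun t ht => ?_).frequently
    simpa using hcover ⟨hx.1.trans ht.1.le, ht.2.trans (min_le_right _ _)⟩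
  have hxK : x ∈ K k :=
    (hK k hk).mem_of_frequently_of_tendsto hfreq (tendsto_id.mono_left nhdsWithin_le_nhds)
  obtain ⟨t, htK, hxt, ht⟩ := (hfreq.and_eventually hxb).exists
  exact ⟨t, hstep k hk x ⟨hxK, hx.1, hx.2.le⟩ t
    ⟨htK, hx.1.trans hxt.le, ht.trans (min_le_right _ _)⟩ hxt hxs,
    hxt, ht.trans (min_le_left _ _)⟩

end Topology

section CubeFaces

variable {ι : Type*}

/-- The face of the cube `[0,1]^ι` on which the coordinates in `I` are `1`, those in `B` are free,
and all others are `0`, written as the order interval from `1_I` to `1_(I ∪ B)`. It parametrizes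
the tile `Π_{I,B}` when `I` and `B` are disjoint. -/
def cubeFace (I B : Finset ι) : Set (ι → ℝ) :=
  Icc ((I : Set ι).indicator 1) ((I ∪ B : Set ι).indicator 1)

variable {I B : Finset ι} {σ τ : ι → ℝ}

lemma mem_cubeFace_iff : σ ∈ cubeFace I B ↔
    σ ∈ Icc 0 1 ∧ (∀ i ∈ I, σ i = 1) ∧ ∀ i, i ∉ I → i ∉ B → σ i = 0 := by
  classical
  simp only [cubeFace, mem_Icc, Pi.le_def, indicator_apply, ← forall_and, mem_union,
    Finset.mem_coe, Pi.zero_apply, Pi.one_apply]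
  refine forall_congr' fun i => ?_
  by_cases hI : i ∈ I <;> by_cases hB : i ∈ B <;> simp [hI, hB] <;> grind

lemma exists_mem_cubeFace_eqOn (hIB : Disjoint I B) {α : ι → ℝ}
    (hα : ∀ i ∈ B, 0 ≤ α i ∧ α i ≤ 1) : ∃ σ ∈ cubeFace I B, EqOn σ α B := by
  classical
  refine ⟨fun i => if i ∈ B then α i else if i ∈ I then 1 else 0, mem_cubeFace_iff.2 ⟨?_, ?_, ?_⟩,
    fun i hi => if_pos hi⟩
  · refine ⟨fun i => ?_, fun i => ?_⟩ <;> simp only [Pi.zero_apply, Pi.one_apply] <;>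
      split_ifs with hB <;> simp [hα i, *]
  · intro i hi
    simp [hi, Finset.disjoint_left.1 hIB hi]
  · intro i hI hB
    simp [hI, hB]

lemma isCompact_cubeFace : IsCompact (cubeFace I B) := isCompact_Icc

lemma apply_eq_of_mem_cubeFace (hσ : σ ∈ cubeFace I B) (hτ : τ ∈ cubeFace I B) {i : ι}
    (hi : i ∉ B) : σ i = τ i := by
  rw [mem_cubeFace_iff] at hσ hτ
  by_cases hI : i ∈ I
  · rw [hσ.2.1 i hI, hτ.2.1 i hI]
  · rw [hσ.2.2 i hI hi, hτ.2.2 i hI hi]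

lemma subset_of_mem_cubeFace (hσ : σ ∈ cubeFace I B) {S : Finset ι}
    (hS : ∀ i ∈ S, σ i ∈ Ioo 0 1) : S ⊆ B := by
  rw [mem_cubeFace_iff] at hσ
  intro i hi
  by_contra hB
  by_cases hI : i ∈ I
  · exact (hS i hi).2.ne (hσ.2.1 i hI)
  · exact (hS i hi).1.ne' (hσ.2.2 i hI hB)

/-- The subcomplex of the cube `[0,1]^ι` formed by the faces labelled by `P`. -/
def cubicalComplex (P : Finset (Finset ι × Finset ι)) : Set (ι → ℝ) :=
  ⋃ t ∈ P, cubeFace t.1 t.2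

variable {P : Finset (Finset ι × Finset ι)}

lemma mem_cubicalComplex_iff : σ ∈ cubicalComplex P ↔ ∃ t ∈ P, σ ∈ cubeFace t.1 t.2 := by
  simp [cubicalComplex]

lemma isCompact_cubicalComplex : IsCompact (cubicalComplex P) :=
  P.isCompact_biUnion fun _ _ => isCompact_cubeFace

lemma cubicalComplex_subset_Icc : cubicalComplex P ⊆ Icc 0 1 := by
  intro σ hσ
  obtain ⟨t, -, hσ⟩ := mem_cubicalComplex_iff.1 hσ
  exact (mem_cubeFace_iff.1 hσ).1

end CubeFaces

section Sections

variable {ι E : Type*} [AddCommGroup E] [Module ℝ E]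

/-- The linear map `σ ↦ ∑_{i ∈ S} σ_i v_i`: the projection of the cube onto the zonotope of `v`,
after deletion of the vectors with index outside `S`. -/
def partialComb (v : ι → E) (S : Finset ι) : (ι → ℝ) →ₗ[ℝ] E :=
  ∑ i ∈ S, (LinearMap.proj i).smulRight (v i)

lemma partialComb_apply (v : ι → E) (S : Finset ι) (σ : ι → ℝ) :
    partialComb v S σ = ∑ i ∈ S, σ i • v i := by
  simp [partialComb]

/-- The complex `P`, with the coordinates outside `S` forgotten, is the image of a section of the
projection of the cube `[0,1]^S` onto the zonotope of `(v_i)_{i ∈ S}`. -/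
structure IsSection (v : ι → E) (P : Finset (Finset ι × Finset ι)) (S : Finset ι) : Prop where
  eqOn : ∀ σ ∈ cubicalComplex P, ∀ τ ∈ cubicalComplex P,
    partialComb v S σ = partialComb v S τ → EqOn σ τ S
  surjOn : SurjOn (partialComb v S) (cubicalComplex P) (partialComb v S '' Icc 0 1)

/-- A section, over the zonotope of `(v_i)_{i ∈ S}`, of the projection of the complex `P`; only its
coordinates in `S` are determined, and outside the zonotope it has arbitrary values. -/
noncomputable def sectionMap (v : ι → E) (P : Finset (Finset ι × Finset ι)) (S : Finset ι) :
    E → ι → ℝ :=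
  Function.invFunOn (partialComb v S) (cubicalComplex P)

variable {v : ι → E} {P : Finset (Finset ι × Finset ι)} {S : Finset ι} {i j : ι} {z : E} {c : ℝ}
  {σ τ : ι → ℝ}

lemma partialComb_add_smul_single [DecidableEq ι] (hi : i ∈ S) (σ : ι → ℝ) (c : ℝ) :
    partialComb v S (σ + c • Pi.single i 1) = partialComb v S σ + c • v i := by
  simp [partialComb_apply, add_smul, Finset.sum_add_distrib, Pi.single_apply, hi]

lemma partialComb_erase [DecidableEq ι] (hi : i ∈ S) (σ : ι → ℝ) :
    partialComb v (S.erase i) σ = partialComb v S σ - σ i • v i := by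
  rw [partialComb_apply, partialComb_apply, Finset.sum_erase_eq_sub hi]

lemma partialComb_update [DecidableEq ι] (hi : i ∈ S) (σ : ι → ℝ) (c : ℝ) :
    partialComb v S (Function.update σ i c) = partialComb v (S.erase i) σ + c • v i := by
  rw [partialComb_apply, partialComb_apply, ← Finset.sum_erase_add _ _ hi, Function.update_self]
  congr 1
  exact Finset.sum_congr rfl fun j hj => by
    rw [Function.update_of_ne (Finset.ne_of_mem_erase hj)]

lemma sectionMap_mem (hz : z ∈ partialComb v S '' cubicalComplex P) :
    sectionMap v P S z ∈ cubicalComplex P :=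
  Function.invFunOn_mem hz

lemma partialComb_sectionMap (hz : z ∈ partialComb v S '' cubicalComplex P) :
    partialComb v S (sectionMap v P S z) = z :=
  Function.invFunOn_eq hz

lemma eqOn_of_partialComb_eq {B : Finset ι} (hB : LinearIndepOn ℝ v B)
    (hστ : ∀ j, j ∉ B → σ j = τ j) (h : partialComb v S σ = partialComb v S τ) : EqOn σ τ S := by
  classical
  have hsum : ∑ j ∈ S ∩ B, σ j • v j = ∑ j ∈ S ∩ B, τ j • v j := by
    rw [partialComb_apply, partialComb_apply, ← Finset.sum_inter_add_sum_sdiff S B,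
      ← Finset.sum_inter_add_sum_sdiff S B] at h
    refine add_right_cancel (h.trans <| congrArg _ <| Finset.sum_congr rfl fun j hj => ?_)
    rw [hστ j (Finset.mem_sdiff.1 hj).2]
  intro j hj
  by_cases hjB : j ∈ B
  · exact linearIndepOn_finset_iffₛ.1 (hB.mono (Finset.coe_subset.2 Finset.inter_subset_right))
      σ τ hsum j (Finset.mem_inter.2 ⟨hj, hjB⟩)
  · exact hστ j hjB

lemma apply_eq_or_eq_add_of_mem_cubeFace {I B : Finset ι} (hB : LinearIndepOn ℝ v B)
    (hσ : σ ∈ cubeFace I B) (hτ : τ ∈ cubeFace I B) (hi : i ∈ S)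
    (h : partialComb v S τ = partialComb v S σ + c • v i) :
    τ i = σ i ∨ τ i = σ i + c ∧ ∀ j ∈ S, j ≠ i → τ j = σ j := by
  classical
  by_cases hiB : i ∈ B
  swap
  · exact Or.inl (apply_eq_of_mem_cubeFace hτ hσ hiB)
  have hoff : ∀ j, j ∉ B → τ j = (σ + c • Pi.single i 1 : ι → ℝ) j := fun j hj => by
    simp [ne_of_mem_of_not_mem hiB hj |>.symm, apply_eq_of_mem_cubeFace hτ hσ hj]
  have heq := eqOn_of_partialComb_eq hB hoff (h.trans (partialComb_add_smul_single hi σ c).symm)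
  exact Or.inr ⟨by simpa using heq hi, fun j hj hji => by simpa [hji] using heq hj⟩

namespace IsSection

lemma sectionMap_partialComb (h : IsSection v P S) (hσ : σ ∈ cubicalComplex P) :
    EqOn (sectionMap v P S (partialComb v S σ)) σ S :=
  h.eqOn _ (sectionMap_mem (mem_image_of_mem _ hσ)) σ hσ
    (partialComb_sectionMap (mem_image_of_mem _ hσ))

lemma image_eq (h : IsSection v P S) :
    partialComb v S '' cubicalComplex P = partialComb v S '' Icc 0 1 :=
  (image_mono cubicalComplex_subset_Icc).antisymm h.surjOn

lemma add_smul_mem_image (h : IsSection v P S) {w : E}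
    (h₀ : z ∈ partialComb v S '' cubicalComplex P)
    (h₁ : z + c • w ∈ partialComb v S '' cubicalComplex P) {t : ℝ} (ht : t ∈ Icc 0 c) :
    z + t • w ∈ partialComb v S '' cubicalComplex P := by
  have hconv : Convex ℝ (partialComb v S '' cubicalComplex P) :=
    h.image_eq ▸ (convex_Icc 0 1).linear_image _
  have hord := (hconv.affine_preimage (AffineMap.lineMap z (z + w))).ordConnected
  simpa [AffineMap.lineMap_apply, add_comm] using
    hord.out (x := 0) (y := c) (by simpa using h₀)
      (by simpa [AffineMap.lineMap_apply, add_comm] using h₁) ht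

variable [TopologicalSpace E] [IsTopologicalAddGroup E] [ContinuousSMul ℝ E] [T2Space E]

lemma continuousOn_sectionMap [Finite ι] (h : IsSection v P S) (hj : j ∈ S) :
    ContinuousOn (fun z => sectionMap v P S z j) (partialComb v S '' cubicalComplex P) :=
  continuousOn_image_of_continuousOn_comp isCompact_cubicalComplex
    (LinearMap.continuous_of_finiteDimensional _).continuousOn
    ((continuous_apply j).continuousOn.congr fun _ hσ => h.sectionMap_partialComb hσ hj)

lemma Icc_subset_of_step [Finite ι] (h : IsSection v P S)
    (hP : ∀ t ∈ P, LinearIndepOn ℝ v t.2) (hi : i ∈ S)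
    (hz : ∀ t ∈ Icc 0 c, z + t • v i ∈ partialComb v S '' cubicalComplex P) {A : Set ℝ}
    (hA : IsClosed (A ∩ Icc 0 c)) (h₀ : 0 ∈ A)
    (hstep : ∀ x ∈ Icc 0 c, ∀ y ∈ Icc 0 c, x < y → x ∈ A →
      (sectionMap v P S (z + y • v i) i = sectionMap v P S (z + x • v i) i ∨
        sectionMap v P S (z + y • v i) i = sectionMap v P S (z + x • v i) i + (y - x) ∧
          ∀ j ∈ S, j ≠ i →
            sectionMap v P S (z + y • v i) j = sectionMap v P S (z + x • v i) j) → y ∈ A) :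
    Icc 0 c ⊆ A := by
  refine Icc_subset_of_finite_closed_cover (P := P)
    (K := fun t => (fun x : ℝ => z + x • v i) ⁻¹' (partialComb v S '' cubeFace t.1 t.2))
    hA h₀ (fun t _ => ?_) (fun x hx => ?_) ?_
  · exact (isCompact_cubeFace.image
      (LinearMap.continuous_of_finiteDimensional _)).isClosed.preimage (by fun_prop)
  · obtain ⟨σ, hσ, hσx⟩ := hz x hx
    obtain ⟨t, ht, hσt⟩ := mem_cubicalComplex_iff.1 hσ
    exact mem_biUnion ht ⟨σ, hσt, hσx⟩
  · rintro t ht x ⟨⟨σ, hσ, hσx⟩, hx⟩ y ⟨⟨τ, hτ, hτy⟩, hy⟩ hxy hxA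
    have hσS := h.sectionMap_partialComb (mem_cubicalComplex_iff.2 ⟨t, ht, hσ⟩)
    have hτS := h.sectionMap_partialComb (mem_cubicalComplex_iff.2 ⟨t, ht, hτ⟩)
    rw [hσx] at hσS
    rw [hτy] at hτS
    refine hstep x hx y hy hxy hxA ?_
    rw [hσS hi, hτS hi]
    refine (apply_eq_or_eq_add_of_mem_cubeFace (hP t ht) hσ hτ hi ?_).imp_right <|
      And.imp_right fun hj j hjS hji => ?_
    · simp only [hσx, hτy]
      module
    · rw [hσS hjS, hτS hjS, hj j hjS hji]

lemma surjOn_erase [Finite ι] [DecidableEq ι] (h : IsSection v P S) (hi : i ∈ S) :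
    SurjOn (partialComb v (S.erase i)) (cubicalComplex P)
      (partialComb v (S.erase i) '' Icc 0 1) := by
  rintro - ⟨ρ, hρ, rfl⟩
  set z := partialComb v (S.erase i) ρ
  have hmem : ∀ t ∈ Icc (0 : ℝ) 1, z + t • v i ∈ partialComb v S '' cubicalComplex P := by
    intro t ht
    rw [h.image_eq]
    refine ⟨Function.update ρ i t, ?_, partialComb_update hi ρ t⟩
    exact ⟨le_update_iff.2 ⟨ht.1, fun j _ => hρ.1 j⟩, update_le_iff.2 ⟨ht.2, fun j _ => hρ.2 j⟩⟩
  have hcont : ContinuousOn (fun t : ℝ => sectionMap v P S (z + t • v i) i) (Icc 0 1) :=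
    (h.continuousOn_sectionMap hi).comp (by fun_prop) hmem
  have hmaps : MapsTo (fun t : ℝ => sectionMap v P S (z + t • v i) i) (Icc 0 1) (Icc 0 1) :=
    fun t ht =>
      have hs := cubicalComplex_subset_Icc (sectionMap_mem (hmem t ht))
      ⟨hs.1 i, hs.2 i⟩
  -- If the section over `z + t v_i` has `i`-th coordinate `t`, deleting it gives a point over `z`.
  obtain ⟨t, ht, hfix⟩ := exists_mem_Icc_isFixedPt_of_mapsTo hcont zero_le_one hmaps
  refine ⟨_, sectionMap_mem (hmem t ht), ?_⟩
  rw [partialComb_erase hi, partialComb_sectionMap (hmem t ht), hfix.eq, add_sub_cancel_right]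

variable [Finite ι] (h : IsSection v P S) (hP : ∀ t ∈ P, LinearIndepOn ℝ v t.2)
include h hP

lemma sectionMap_add_smul_apply_le (hi : i ∈ S) (hc : 0 ≤ c)
    (hz : z ∈ partialComb v S '' cubicalComplex P)
    (hzc : z + c • v i ∈ partialComb v S '' cubicalComplex P) :
    sectionMap v P S (z + c • v i) i ≤ sectionMap v P S z i + c := by
  have hseg := fun t => h.add_smul_mem_image hz hzc (t := t)
  have hcont : ContinuousOn (fun t => sectionMap v P S (z + t • v i) i) (Icc 0 c) :=
    (h.continuousOn_sectionMap hi).comp (by fun_prop) hseg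
  have hclosed : IsClosed
      ({t | sectionMap v P S (z + t • v i) i ≤ sectionMap v P S z i + t} ∩ Icc 0 c) := by
    rw [inter_comm]
    exact isClosed_Icc.isClosed_le hcont (by fun_prop)
  refine h.Icc_subset_of_step hP hi hseg hclosed (by simp) ?_ (right_mem_Icc.2 hc)
  rintro x - y - hxy hx (hy | ⟨hy, -⟩) <;> simp only [mem_ofPred_eq] at hx ⊢ <;> linarith

lemma sectionMap_add_smul_apply_self (hi : i ∈ S)
    (hz : z ∈ partialComb v S '' cubicalComplex P)
    (hzc : z + c • v i ∈ partialComb v S '' cubicalComplex P)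
    (heq : sectionMap v P S (z + c • v i) i = sectionMap v P S z i + c) {t : ℝ}
    (ht : t ∈ Icc 0 c) :
    sectionMap v P S (z + t • v i) i = sectionMap v P S z i + t := by
  have hzt := h.add_smul_mem_image hz hzc ht
  have hsplit : z + c • v i = z + t • v i + (c - t) • v i := by module
  have hlow := h.sectionMap_add_smul_apply_le hP hi ht.1 hz hzt
  have hhigh := h.sectionMap_add_smul_apply_le hP hi (sub_nonneg.2 ht.2) hzt (hsplit ▸ hzc)
  rw [← hsplit, heq] at hhigh
  linarith

lemma sectionMap_add_smul_apply_of_ne (hi : i ∈ S) (hj : j ∈ S) (hji : j ≠ i)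
    (hz : z ∈ partialComb v S '' cubicalComplex P)
    (hzc : z + c • v i ∈ partialComb v S '' cubicalComplex P)
    (heq : sectionMap v P S (z + c • v i) i = sectionMap v P S z i + c) {t : ℝ}
    (ht : t ∈ Icc 0 c) :
    sectionMap v P S (z + t • v i) j = sectionMap v P S z j := by
  have hseg := fun t => h.add_smul_mem_image hz hzc (t := t)
  have hslope := fun t => h.sectionMap_add_smul_apply_self hP hi hz hzc heq (t := t)
  have hcont : ContinuousOn (fun t => sectionMap v P S (z + t • v i) j) (Icc 0 c) :=
    (h.continuousOn_sectionMap hj).comp (by fun_prop) hseg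
  have hclosed : IsClosed
      ({t | sectionMap v P S (z + t • v i) j = sectionMap v P S z j} ∩ Icc 0 c) := by
    rw [inter_comm]
    exact hcont.preimage_isClosed_of_isClosed isClosed_Icc isClosed_singleton
  refine h.Icc_subset_of_step hP hi hseg hclosed (by simp) ?_ ht
  rintro x hx y hy hxy hxz (hconst | ⟨-, hrest⟩)
  · rw [hslope x hx, hslope y hy] at hconst
    linarith
  · exact (hrest j hj hji).trans hxz

lemma exists_apply_eq_add (hσ : σ ∈ cubicalComplex P) (hτ : τ ∈ cubicalComplex P) (hi : i ∈ S)
    (hτσ : partialComb v S τ = partialComb v S σ + (τ i - σ i) • v i) {t : ℝ}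
    (ht : t ∈ Icc 0 (τ i - σ i)) :
    ∃ ρ ∈ cubicalComplex P, partialComb v S ρ = partialComb v S σ + t • v i ∧
      ρ i = σ i + t ∧ ∀ j ∈ S, j ≠ i → ρ j = σ j := by
  have hz := mem_image_of_mem (partialComb v S) hσ
  have hzc := mem_image_of_mem (partialComb v S) hτ
  have hσS := h.sectionMap_partialComb hσ
  have heq : sectionMap v P S (partialComb v S τ) i =
      sectionMap v P S (partialComb v S σ) i + (τ i - σ i) := by
    rw [h.sectionMap_partialComb hτ hi, hσS hi, add_sub_cancel]
  rw [hτσ] at hzc heq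
  have hzt := h.add_smul_mem_image hz hzc ht
  refine ⟨_, sectionMap_mem hzt, partialComb_sectionMap hzt, ?_, fun j hj hji => ?_⟩
  · rw [h.sectionMap_add_smul_apply_self hP hi hz hzc heq ht, hσS hi]
  · rw [h.sectionMap_add_smul_apply_of_ne hP hi hj hji hz hzc heq ht, hσS hj]

lemma apply_eq_of_eq_add_smul (hσ : σ ∈ cubicalComplex P) (hτ : τ ∈ cubicalComplex P)
    (hi : i ∈ S) (hτσ : partialComb v S τ = partialComb v S σ + (τ i - σ i) • v i) (hj : j ∈ S)
    (hji : j ≠ i) : τ j = σ j := by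
  wlog hc : σ i ≤ τ i generalizing σ τ
  · refine (this hτ hσ ?_ (le_of_not_ge hc)).symm
    rw [hτσ]
    module
  obtain ⟨ρ, hρ, hρσ, -, hρj⟩ :=
    h.exists_apply_eq_add hP hσ hτ hi hτσ (right_mem_Icc.2 (sub_nonneg.2 hc))
  rw [← hρj j hj hji, h.eqOn ρ hρ τ hτ (hρσ.trans hτσ.symm) hj]

lemma erase [DecidableEq ι] (i : ι) : IsSection v P (S.erase i) := by
  by_cases hi : i ∈ S
  swap
  · rwa [Finset.erase_eq_of_notMem hi]
  refine ⟨fun σ hσ τ hτ hστ j hj => ?_, h.surjOn_erase hi⟩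
  rw [partialComb_erase hi, partialComb_erase hi, sub_eq_sub_iff_add_eq_add] at hστ
  refine h.apply_eq_of_eq_add_smul hP hτ hσ hi ?_ (Finset.mem_of_mem_erase hj)
    (Finset.ne_of_mem_erase hj)
  rw [sub_smul, add_sub, ← hστ, add_sub_cancel_right]

lemma mono {R : Finset ι} (hRS : R ⊆ S) : IsSection v P R := by
  classical
  suffices ∀ D : Finset ι, IsSection v P (S \ D) by
    simpa [Finset.sdiff_sdiff_eq_self hRS] using this (S \ R)
  intro D
  induction D using Finset.induction_on with
  | empty => simpa using h
  | insert i D _ ih => exact Finset.sdiff_insert S D i ▸ ih.erase hP i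

lemma exists_insert_subset_snd [DecidableEq ι] {I J B : Finset ι}
    (hS : insert i B ⊆ S) (hI : (I, B) ∈ P) (hJ : (J, B) ∈ P) (hIB : Disjoint I B)
    (hJB : Disjoint J B) (hiI : i ∈ I) (hiJ : i ∉ J) : ∃ t ∈ P, insert i B ⊆ t.2 := by
  have hiB : i ∉ B := Finset.disjoint_left.1 hIB hiI
  obtain ⟨τ, hτI, hτB⟩ := exists_mem_cubeFace_eqOn hIB (α := fun _ => 1 / 2) (by norm_num)
  obtain ⟨σ, hσJ, hσB⟩ := exists_mem_cubeFace_eqOn hJB (α := fun _ => 1 / 2) (by norm_num)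
  have hτi : τ i = 1 := (mem_cubeFace_iff.1 hτI).2.1 i hiI
  have hσi : σ i = 0 := (mem_cubeFace_iff.1 hσJ).2.2 i hiJ hiB
  have hτσ : partialComb v (insert i B) τ =
      partialComb v (insert i B) σ + (τ i - σ i) • v i := by
    rw [partialComb_apply, partialComb_apply, Finset.sum_insert hiB, Finset.sum_insert hiB,
      Finset.sum_congr rfl fun j hj => by rw [hτB hj, ← hσB hj]]
    module
  obtain ⟨ρ, hρ, -, hρi, hρB⟩ := (h.mono hP hS).exists_apply_eq_add hP
    (mem_cubicalComplex_iff.2 ⟨_, hJ, hσJ⟩) (mem_cubicalComplex_iff.2 ⟨_, hI, hτI⟩)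
    (Finset.mem_insert_self i B) hτσ (t := 1 / 2) (by norm_num [hτi, hσi])
  obtain ⟨t, ht, hρt⟩ := mem_cubicalComplex_iff.1 hρ
  refine ⟨t, ht, subset_of_mem_cubeFace hρt fun j hj => ?_⟩
  obtain rfl | hjB := Finset.mem_insert.1 hj
  · norm_num [hρi, hσi]
  · rw [hρB j hj (ne_of_mem_of_not_mem hjB hiB), hσB hjB]
    norm_num

lemma exists_subset_snd {B : Finset ι} (hBS : B ⊆ S) (hB : LinearIndepOn ℝ v B) :
    ∃ t ∈ P, B ⊆ t.2 := by
  have hhalf : (fun _ => 1 / 2 : ι → ℝ) ∈ Icc 0 1 := by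
    constructor <;> intro i <;> norm_num
  obtain ⟨σ, hσ, hσhalf⟩ := (h.mono hP hBS).surjOn (mem_image_of_mem _ hhalf)
  rw [partialComb_apply, partialComb_apply] at hσhalf
  obtain ⟨t, ht, hσt⟩ := mem_cubicalComplex_iff.1 hσ
  refine ⟨t, ht, subset_of_mem_cubeFace hσt fun i hi => ?_⟩
  rw [linearIndepOn_finset_iffₛ.1 hB _ _ hσhalf i hi]
  norm_num

theorem existsUnique_snd_eq [Module.Finite ℝ E] {B : Finset ι} (hBS : B ⊆ S)
    (hdisj : ∀ t ∈ P, Disjoint t.1 t.2) (hS : ∀ t ∈ P, t.1 ⊆ S) (hB : LinearIndepOn ℝ v B)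
    (hcard : B.card = Module.finrank ℝ E) : ∃! t, t ∈ P ∧ t.2 = B := by
  classical
  have hle : ∀ t ∈ P, t.2.card ≤ B.card := fun t ht => by
    simpa [hcard] using (hP t ht).linearIndependent.fintype_card_le_finrank
  have hsub : ∀ I J, (I, B) ∈ P → (J, B) ∈ P → I ⊆ J := fun I J hI hJ i hiI => by
    by_contra hiJ
    obtain ⟨u, hu, hBu⟩ := h.exists_insert_subset_snd hP
      (Finset.insert_subset (hS _ hI hiI) hBS) hI hJ (hdisj _ hI) (hdisj _ hJ) hiI hiJ
    have hiB : i ∉ B := Finset.disjoint_left.1 (hdisj _ hI) hiI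
    exact absurd ((Finset.card_le_card hBu).trans (hle u hu)) (by simp [hiB])
  obtain ⟨t, ht, hBt⟩ := h.exists_subset_snd hP hBS hB
  have htB : t.2 = B := (Finset.eq_of_subset_of_card_le hBt (hle t ht)).symm
  refine ⟨t, ⟨ht, htB⟩, fun u ⟨hu, huB⟩ => Prod.ext ?_ (huB.trans htB.symm)⟩
  exact (hsub u.1 t.1 (huB ▸ hu) (htB ▸ ht)).antisymm (hsub t.1 u.1 (htB ▸ ht) (huB ▸ hu))

end IsSection

end Sections

section Tilings

variable {n d : ℕ} {a : Fin n → Fin d → ℝ} {P : Finset (Tile n)}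

lemma IsFace.cubeFace_subset {J C I B : Finset (Fin n)} (h : IsFace J C I B) :
    cubeFace J C ⊆ cubeFace I B := by
  obtain ⟨hCB, hIJ, hJ, -⟩ := h
  have hJC : J ∪ C ⊆ I ∪ B := Finset.union_subset hJ (hCB.trans Finset.subset_union_right)
  refine Icc_subset_Icc (indicator_le_indicator_of_subset (Finset.coe_subset.2 hIJ) ?_)
    (indicator_le_indicator_of_subset (by exact_mod_cast hJC) ?_) <;> simp

lemma zonotope_eq_image :
    zonotope a = partialComb (fun i => lift (a i)) Finset.univ '' Icc 0 1 := by
  ext z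
  simp only [zonotope, mem_image, partialComb_apply, mem_Icc, Pi.le_def, ← forall_and]
  exact exists_congr fun _ => and_congr_right fun _ => eq_comm

lemma parallelepiped_eq_image {I B : Finset (Fin n)} (hIB : Disjoint I B) :
    parallelepiped a I B = partialComb (fun i => lift (a i)) Finset.univ '' cubeFace I B := by
  have hsum : ∀ σ ∈ cubeFace I B, partialComb (fun i => lift (a i)) Finset.univ σ =
      ∑ i ∈ I, lift (a i) + ∑ b ∈ B, σ b • lift (a b) := by
    intro σ hσ
    rw [mem_cubeFace_iff] at hσ
    rw [partialComb_apply, ← Finset.sum_subset (Finset.subset_univ (I ∪ B)),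
      Finset.sum_union hIB]
    · congr 1
      exact Finset.sum_congr rfl fun i hi => by rw [hσ.2.1 i hi, one_smul]
    · intro i _ hi
      rw [Finset.mem_union, not_or] at hi
      rw [hσ.2.2 i hi.1 hi.2, zero_smul]
  ext z
  constructor
  · rintro ⟨α, hα, rfl⟩
    obtain ⟨σ, hσ, hσα⟩ := exists_mem_cubeFace_eqOn hIB hα
    refine ⟨σ, hσ, ?_⟩
    rw [hsum σ hσ]
    congr 1
    exact Finset.sum_congr rfl fun b hb => by rw [hσα hb]
  · rintro ⟨σ, hσ, rfl⟩
    have h01 := (mem_cubeFace_iff.1 hσ).1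
    exact ⟨σ, fun b _ => ⟨h01.1 b, h01.2 b⟩, hsum σ hσ⟩

lemma linearIndependent_lift_iff {ι : Type*} (p : ι → Fin d → ℝ) :
    LinearIndependent ℝ (fun i => lift (p i)) ↔ AffineIndependent ℝ p := by
  rw [affineIndependent_iff, linearIndependent_iff']
  refine forall₂_congr fun s w => ?_
  rw [← and_imp]
  refine imp_congr_left ⟨fun h => ⟨?_, ?_⟩, fun ⟨hsum, hcomb⟩ => ?_⟩
  · simpa [lift, Finset.sum_apply] using congrFun h (Fin.last d)
  · ext j
    simpa [lift, Finset.sum_apply] using congrFun h j.castSucc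
  · ext j
    refine Fin.lastCases ?_ (fun j => ?_) j
    · simpa [lift, Finset.sum_apply] using hsum
    · simpa [lift, Finset.sum_apply] using congrFun hcomb j

lemma linearIndepOn_lift_iff {B : Finset (Fin n)} :
    LinearIndepOn ℝ (fun i => lift (a i)) B ↔ AffineIndependent ℝ fun b : B => a b :=
  linearIndependent_lift_iff fun b : B => a b

lemma det_pos_iff {B : Finset (Fin n)} (h : B.card = d + 1) :
    0 < det a B ↔ AffineIndependent ℝ fun b : B => a b := by
  have hrows : LinearIndependent ℝ (rowMatrix a B h).row ↔
      LinearIndepOn ℝ (fun i => lift (a i)) B :=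
    linearIndependent_equiv (B.orderIsoOfFin h).toEquiv (f := fun b : B => lift (a b))
  rw [det, dif_pos h, abs_pos, ← isUnit_iff_ne_zero, ← Matrix.isUnit_iff_isUnit_det,
    ← Matrix.linearIndependent_rows_iff_isUnit, hrows, linearIndepOn_lift_iff]

namespace IsFineZonotopalTiling

variable (hP : IsFineZonotopalTiling a P)
include hP

lemma affineIndependent {t : Tile n} (ht : t ∈ P) : AffineIndependent ℝ fun b : t.2 => a b :=
  (det_pos_iff (hP.card_eq t ht)).1 (hP.det_pos t ht)

lemma isSection : IsSection (fun i => lift (a i)) P Finset.univ := by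
  set φ := partialComb (fun i => lift (a i)) Finset.univ
  have htile : ∀ t ∈ P, parallelepiped a t.1 t.2 = φ '' cubeFace t.1 t.2 := fun t ht =>
    parallelepiped_eq_image (hP.disjoint t ht)
  have hinj : ∀ t ∈ P, InjOn φ (cubeFace t.1 t.2) := fun t ht σ hσ τ hτ hστ => by
    simpa using eqOn_of_partialComb_eq (linearIndepOn_lift_iff.2 (hP.affineIndependent ht))
      (fun j => apply_eq_of_mem_cubeFace hσ hτ) hστ
  refine ⟨fun σ hσ τ hτ hστ => ?_, ?_⟩
  · obtain ⟨t, ht, hσt⟩ := mem_cubicalComplex_iff.1 hσ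
    obtain ⟨u, hu, hτu⟩ := mem_cubicalComplex_iff.1 hτ
    have hmem : φ σ ∈ parallelepiped a t.1 t.2 ∩ parallelepiped a u.1 u.2 := by
      rw [htile t ht, htile u hu]
      exact ⟨mem_image_of_mem φ hσt, τ, hτu, hστ.symm⟩
    obtain ⟨J, C, hft, hfu, hJC⟩ := hP.inter t ht u hu ⟨_, hmem⟩
    rw [hJC, parallelepiped_eq_image hft.2.2.2] at hmem
    obtain ⟨ρ, hρ, hρσ⟩ := hmem
    obtain rfl := hinj t ht (hft.cubeFace_subset hρ) hσt hρσ
    obtain rfl := hinj u hu (hfu.cubeFace_subset hρ) hτu hστ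
    exact eqOn_refl _ _
  · rw [← zonotope_eq_image, ← hP.cover, SurjOn, cubicalComplex, image_iUnion₂]
    exact iUnion₂_mono fun t ht => (htile t ht).subset

theorem existsUnique_tile {B : Finset (Fin n)} (hB : B.card = d + 1)
    (hBa : AffineIndependent ℝ fun b : B => a b) : ∃! t, t ∈ P ∧ t.2 = B :=
  hP.isSection.existsUnique_snd_eq
    (fun _ ht => linearIndepOn_lift_iff.2 (hP.affineIndependent ht)) (Finset.subset_univ B)
    hP.disjoint (fun _ _ => Finset.subset_univ _) (linearIndepOn_lift_iff.2 hBa) (by simpa using hB)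

theorem card_eq_ncard :
    P.card = {B : Finset (Fin n) |
      B.card = d + 1 ∧ AffineIndependent ℝ (fun b : B => a b)}.ncard := by
  rw [← Set.ncard_coe_finset]
  refine Set.ncard_congr (fun t _ => t.2) (fun t ht => ⟨hP.card_eq t ht, hP.affineIndependent ht⟩)
    (fun t u ht hu htu => ?_) fun B hB => ?_
  · exact (hP.existsUnique_tile (hP.card_eq t ht) (hP.affineIndependent ht)).unique
      ⟨ht, rfl⟩ ⟨hu, htu.symm⟩
  · obtain ⟨t, ⟨ht, htB⟩, -⟩ := hP.existsUnique_tile hB.1 hB.2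
    exact ⟨t, ht, htB⟩

lemma sum_card_tilesOfOrder :
    ∑ k ∈ Finset.range (n - d), (tilesOfOrder P k).card = P.card := by
  refine (Finset.card_eq_sum_card_fiberwise (f := fun t : Tile n => t.1.card) fun t ht => ?_).symm
  have h := Finset.card_le_univ (t.1 ∪ t.2)
  rw [Finset.card_union_of_disjoint (hP.disjoint t ht), hP.card_eq t ht, Fintype.card_fin] at h
  simp only [Finset.coe_range, Set.mem_Iio]
  omega

end IsFineZonotopalTiling

end Tilings

end ZonotopalSplines

theorem corollary3 {n d : ℕ} (a : Fin n → Fin d → ℝ)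
    (ha : affineSpan ℝ (Set.range a) = ⊤)
    (P : Finset (ZonotopalSplines.Tile n)) (hP : ZonotopalSplines.IsFineZonotopalTiling a P)
    (T : Finset (Fin n) → Finset (Finset (Fin n))) (hT : ZonotopalSplines.Constructs a T P) :
    ∑ k ∈ Finset.range (n - d), Multiset.card (ZonotopalSplines.builtSplines a T k) =
      {B : Finset (Fin n) |
        B.card = d + 1 ∧ AffineIndependent ℝ (fun b : B => a b)}.ncard := by
  rw [← hP.card_eq_ncard, ← hP.sum_card_tilesOfOrder]
  refine Finset.sum_congr rfl fun k hk => ?_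
  rw [← hT.built k (Finset.mem_range.1 hk)]
  exact Multiset.card_map _ _
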